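/- Let $S$ be a finite set of states. A simple stochastic game (SSG) $G=(S,A,T,R,S_{\max},S_{\min})$ consists of finite sets $A(s)$ of enabled actions ($s\in S$), with $A=\bigcup_s A(s)$; a transition function $T\colon S\times A\times S\to[0,1]$ with $T_a(s):=\sum_{s'}T_a(s,s')\le 1$; rewards $R_a(s)\in[0,\infty)$; and a partition $S=S_{\max}\sqcup S_{\min}$. Its Bellman operator $f_G\colon[0,\infty)^S\to[0,\infty)^S$ sends $v$ to the function whose value at $s$ is the maximum (if $s\in S_{\max}$) or minimum (if $s\in S_{\min}$) over $a\in A(s)$ of $R_a(s)+\sum_{s'}T_a(s,s')v(s')$, and is $0$ if $A(s)=\emptyset$. $G$ is a Markov decision process (MDP) if $|A(s)|\le1$ for all $s\in S_{\min}$. A sequence $(G_n)_{n\ge0}$ of SSGs with the same $S,A,S_{\max},S_{\min}$ is a sampling of $G$ if $T_n\to T$, $R_n\to R$ and, for all $n\ge1$, $s,s'\in S$, $a\in A$: $T_a(s,s')=0$ implies $(T_n)_a(s,s')=0$; $R_a(s)=0$ implies $(R_n)_a(s)=0$; $T_a(s)=1$ implies $(T_n)_a(s)=1$. For a function $f\colon[0,\infty)^S\to[0,\infty)^S$,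 $\mu f\in[0,\infty]^S$ denotes the least fixpoint of the extension $\bar f\colon[0,\infty]^S\to[0,\infty]^S$, $\bar f(x)=\sup\{f(y)\mid y\in[0,\infty)^S,\ y\le x\}$. A (dampened) Mann scheme is a pair of sequences $\alpha_n\in[0,1]$, $\beta_n\in[0,1)$ with $\beta_n\to0$ and $\sum_n\beta_n=\infty$; it is progressing if $\beta_n/\alpha_n\to0$, where $0/0=0$ and $x/0=\infty$ for $x>0$. On functions $f_n\colon[0,\infty)^S\to[0,\infty)^S$ it generates the sequences $(x_n)$ with $x_0\in[0,\infty)^S$ arbitrary and $x_{n+1}=(1-\beta_n)\cdot(x_n+\alpha_n\cdot(f_n(x_n)-x_n))$. A generalized Mann scheme has parameters $\alpha_n\in[0,1]^S$, $\beta_n\in[0,1)^S$ satisfying these conditions in each component, and the iteration is read componentwise; it is progressing if $\beta_n(i)/\alpha_n(i)\to0$ for all $i\in S$ and there is a strictly increasing sequence $(m_k)_{k\ge0}$ of natural numbers such that for all $k$ and $i$ the set $\{\ell\mid m_k\le\ell<m_{k+1},\ \alpha_\ell(i)>0\}$ is non-empty and, with $\ell_k(i)$ its maximum, $\sum_k\min_{i}\beta_{\ell_k(i)}(i)=\infty$.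 **Theorem.** Let $(M_n)_{n\ge0}$ be a sampling of an MDP $M$. Then the pointwise suprema $\sup_{k\ge n}f_{M_k}$ are finite and $$\lim_{n\to\infty}\mu\Bigl(\sup_{k\ge n}f_{M_k}\Bigr)=\mu f_M\quad\text{in }[0,\infty]^S.$$ As a consequence, for every progressing Mann scheme, and for every progressing generalized Mann scheme, every sequence $(x_n)$ that it generates on $(f_{M_n})$ converges to $\mu f_M$ in $[0,\infty]^S$. -/

import Mathlib

open Filter Topology
open scoped NNReal ENNReal

/-! ### Simple stochastic games and Markov decision processes -/

/-- A simple stochastic game with finite state set `S`, finite sets `A s` of enabled actions,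
sub-stochastic transitions `T s a s'` (written `T_a(s,s')` in the literature), non-negative rewards
`R s a` and a partition of the states into max-states and min-states. The relevant actions are the
elements of `⋃ s, A s`; the values of `T` and `R` at other elements of `Act` play no role. -/
structure SSG (S Act : Type*) [Fintype S] where
  A : S → Finset Act
  T : S → Act → S → ℝ≥0
  R : S → Act → ℝ≥0
  Smax : Set S
  Smin : Set S
  sum_le_one : ∀ s, ∀ a ∈ ⋃ t, (A t : Set Act), ∑ s', T s a s' ≤ 1
  partition : IsCompl Smax Smin

namespace SSG

variable {S Act : Type*} [Fintype S]

/-- The set `⋃ s, A s` of all actions. -/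
def actions (G : SSG S Act) : Set Act := ⋃ s, (G.A s : Set Act)

/-- The total transition mass `T_a(s)`; the system terminates with probability `1 - T_a(s)`. -/
def mass (G : SSG S Act) (s : S) (a : Act) : ℝ≥0 := ∑ s', G.T s a s'

/-- `R_a(s) + ∑ s', T_a(s,s') v(s')`. -/
def actionValue (G : SSG S Act) (v : S → ℝ≥0) (s : S) (a : Act) : ℝ≥0 :=
  G.R s a + ∑ s', G.T s a s' * v s'

open Classical in
/-- The Bellman operator: the maximum (at max-states) or minimum (at min-states) of the values of
the enabled actions, and `0` at final states, where no action is enabled. -/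
noncomputable def bellman (G : SSG S Act) (v : S → ℝ≥0) (s : S) : ℝ≥0 :=
  if h : (G.A s).Nonempty then
    if s ∈ G.Smax then (G.A s).sup' h (G.actionValue v s)
    else (G.A s).inf' h (G.actionValue v s)
  else 0

/-- A (maximizing) Markov decision process: the min-player never has a choice. -/
def IsMDP (G : SSG S Act) : Prop := ∀ s ∈ G.Smin, (G.A s).card ≤ 1

/-- `(Gn n)` is a sampling of `G`: same states, actions and players, with transitions and rewards
converging to those of `G`; a transition or reward that is zero in `G` and termination of an action
that does not terminate in `G` are never observed in `Gn n`, `n ≥ 1`. -/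
structure IsSampling (G : SSG S Act) (Gn : ℕ → SSG S Act) : Prop where
  A_eq : ∀ n, (Gn n).A = G.A
  Smax_eq : ∀ n, (Gn n).Smax = G.Smax
  Smin_eq : ∀ n, (Gn n).Smin = G.Smin
  tendsto_T : ∀ s, ∀ a ∈ G.actions, ∀ s',
    Tendsto (fun n => (Gn n).T s a s') atTop (𝓝 (G.T s a s'))
  tendsto_R : ∀ s, ∀ a ∈ G.actions, Tendsto (fun n => (Gn n).R s a) atTop (𝓝 (G.R s a))
  T_zero : ∀ s, ∀ a ∈ G.actions, ∀ s', G.T s a s' = 0 → ∀ n, 1 ≤ n → (Gn n).T s a s' = 0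
  R_zero : ∀ s, ∀ a ∈ G.actions, G.R s a = 0 → ∀ n, 1 ≤ n → (Gn n).R s a = 0
  mass_one : ∀ s, ∀ a ∈ G.actions, G.mass s a = 1 → ∀ n, 1 ≤ n → (Gn n).mass s a = 1

end SSG

/-! ### Least fixpoints in `[0,∞]^ι` -/

/-- The extension of `f : [0,∞)^ι → [0,∞)^ι` to `[0,∞]^ι`, `x ↦ sup {f y | y ≤ x}`, where `y` ranges
over `[0,∞)^ι`. -/
noncomputable def omegaExt {ι : Type*} (f : (ι → ℝ≥0) → ι → ℝ≥0) :
    (ι → ℝ≥0∞) →o (ι → ℝ≥0∞) where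
  toFun x := ⨆ y : {y : ι → ℝ≥0 // ∀ i, (y i : ℝ≥0∞) ≤ x i}, fun i => (f y.1 i : ℝ≥0∞)
  monotone' := by
    intro x x' hx
    refine iSup_le fun y => ?_
    exact le_iSup
      (fun y : {y : ι → ℝ≥0 // ∀ i, (y i : ℝ≥0∞) ≤ x' i} => fun i => (f y.1 i : ℝ≥0∞))
      ⟨y.1, fun i => (y.2 i).trans (hx i)⟩

/-- The least fixpoint `μ f ∈ [0,∞]^ι`, that is, the least fixpoint of the extension of `f`. -/
noncomputable def leastFix {ι : Type*} (f : (ι → ℝ≥0) → ι → ℝ≥0) : ι → ℝ≥0∞ :=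
  (omegaExt f).lfp

/-- The pointwise supremum `sup_{k ≥ n} f_k`. -/
noncomputable def tailSup {ι : Type*} (f : ℕ → (ι → ℝ≥0) → ι → ℝ≥0) (n : ℕ) :
    (ι → ℝ≥0) → ι → ℝ≥0 :=
  fun v i => ⨆ k : Set.Ici n, f k v i

/-! ### Dampened Mann schemes -/

/-- A dampened Mann scheme: learning rates `α n` and dampening factors `β n`. -/
structure MannScheme where
  α : ℕ → ℝ≥0
  β : ℕ → ℝ≥0
  α_le_one : ∀ n, α n ≤ 1
  β_lt_one : ∀ n, β n < 1
  tendsto_β : Tendsto β atTop (𝓝 0)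
  tsum_β : ∑' n, (β n : ℝ≥0∞) = ⊤

/-- The scheme is progressing if `β n / α n → 0`. The quotient is that of `[0,∞]`, in which
`0 / 0 = 0` and `x / 0 = ∞` for `x > 0`. -/
def MannScheme.Progressing (𝒮 : MannScheme) : Prop :=
  Tendsto (fun n => (𝒮.β n : ℝ≥0∞) / (𝒮.α n : ℝ≥0∞)) atTop (𝓝 0)

/-- `x` is a sequence generated by the scheme on the functions `f n`:
`x_{n+1} = (1 - β_n) (x_n + α_n (f_n(x_n) - x_n))`, with `x 0` arbitrary. -/
def MannScheme.Generates {ι : Type*} (𝒮 : MannScheme) (f : ℕ → (ι → ℝ≥0) → ι → ℝ≥0)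
    (x : ℕ → ι → ℝ≥0) : Prop :=
  ∀ n i, (x (n + 1) i : ℝ) =
    (1 - (𝒮.β n : ℝ)) * ((x n i : ℝ) + (𝒮.α n : ℝ) * ((f n (x n) i : ℝ) - (x n i : ℝ)))

/-- A generalized dampened Mann scheme: the parameters also depend on the component `i`. -/
structure GenMannScheme (ι : Type*) where
  α : ℕ → ι → ℝ≥0
  β : ℕ → ι → ℝ≥0
  α_le_one : ∀ n i, α n i ≤ 1
  β_lt_one : ∀ n i, β n i < 1
  tendsto_β : ∀ i, Tendsto (fun n => β n i) atTop (𝓝 0)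
  tsum_β : ∀ i, ∑' n, (β n i : ℝ≥0∞) = ⊤

/-- A generalized scheme is progressing if `β n i / α n i → 0` for every `i` and there are times
`m 0 < m 1 < …` such that every component `i` is updated in each interval `[m k, m (k+1))`, and the
smallest, over `i`, of the dampening factors of `i` at its last update `ℓ k i` in the interval sum
to infinity over `k`. -/
def GenMannScheme.Progressing {ι : Type*} (𝒮 : GenMannScheme ι) : Prop :=
  (∀ i, Tendsto (fun n => (𝒮.β n i : ℝ≥0∞) / (𝒮.α n i : ℝ≥0∞)) atTop (𝓝 0)) ∧
  ∃ (m : ℕ → ℕ) (ℓ : ℕ → ι → ℕ), StrictMono m ∧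
    (∀ k i, IsGreatest {l | m k ≤ l ∧ l < m (k + 1) ∧ 0 < 𝒮.α l i} (ℓ k i)) ∧
    ∑' k, ⨅ i, (𝒮.β (ℓ k i) i : ℝ≥0∞) = ⊤

/-- `x` is a sequence generated by the generalized scheme on the functions `f n`. -/
def GenMannScheme.Generates {ι : Type*} (𝒮 : GenMannScheme ι)
    (f : ℕ → (ι → ℝ≥0) → ι → ℝ≥0) (x : ℕ → ι → ℝ≥0) : Prop :=
  ∀ n i, (x (n + 1) i : ℝ) =
    (1 - (𝒮.β n i : ℝ)) * ((x n i : ℝ) + (𝒮.α n i : ℝ) * ((f n (x n) i : ℝ) - (x n i : ℝ)))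

/-! ### Real sequences -/

/-! Let `v` be the least fixpoint of `M` and `F` the set of states where it is finite. In an MDP no
action enabled in `F` leaves `F`, and no action value at `v` exceeds `v` there. By
`leak_or_constant` such an action either loses mass, reaches a smaller value, or moves surely and
without reward inside a level set of `v`. Adding a small multiple of the potential `1 - q ^ rank`
makes the inequality strict in the first two cases, so it survives a small change of the game. In
the third case the potential is constant along the move, and the support, reward and mass conditions
of a sampling preserve equality. So some `u ≤ v + ε` is a super-fixpoint on `F` for all late `Mn k`
(`exists_superFixpoint_leastFix`), which bounds the limit of the least fixpoints from above. The
lower bound follows from convergence of the action values.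

For the iterates, each set `x ≤ u + c` on `F` is invariant, and dampening shrinks `c` to `0` because
the factors sum to infinity. From below, `β / α → 0` makes the loss by dampening negligible, so the
liminf of the iterates is a super-fixpoint of `M` (`leastFix_le_liminf`). -/

theorem tendsto_zero_of_le_one_sub_mul {a e : ℕ → ℝ} (ha : ∀ n, 0 ≤ a n) (hs : ¬ Summable a)
    (he : ∀ n, 0 ≤ e n) (h : ∀ n, e (n + 1) ≤ (1 - a n) * e n) : Tendsto e atTop (𝓝 0) := by
  have hb : ∀ n, e n ≤ e 0 * Real.exp (-∑ j ∈ Finset.range n, a j) := by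
    intro n
    induction n with
    | zero => simp
    | succ n ih =>
      calc e (n + 1) ≤ (1 - a n) * e n := h n
        _ ≤ Real.exp (-a n) * e n :=
          mul_le_mul_of_nonneg_right (by linarith [Real.add_one_le_exp (-a n)]) (he n)
        _ ≤ Real.exp (-a n) * (e 0 * Real.exp (-∑ j ∈ Finset.range n, a j)) :=
          mul_le_mul_of_nonneg_left ih (Real.exp_pos _).le
        _ = e 0 * Real.exp (-∑ j ∈ Finset.range (n + 1), a j) := by
          rw [Finset.sum_range_succ, neg_add, Real.exp_add]; ring
  have ht := (not_summable_iff_tendsto_nat_atTop_of_nonneg ha).1 hs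
  have h0 : Tendsto (fun n => e 0 * Real.exp (-∑ j ∈ Finset.range n, a j)) atTop (𝓝 0) := by
    simpa using (Real.tendsto_exp_neg_atTop_nhds_zero.comp ht).const_mul (e 0)
  exact squeeze_zero he hb h0

/-- An invariant `I k c` whose bound `c` contracts by the factors `1 - b k` holds for arbitrarily
small bounds. -/
theorem exists_le_of_contracting {I : ℕ → ℝ → Prop} {b : ℕ → ℝ} (hb : ∀ k, 0 ≤ b k)
    (hb1 : ∀ k, b k ≤ 1) (hs : ¬ Summable b)
    (hI : ∀ k c, 0 ≤ c → I k c → I (k + 1) ((1 - b k) * c)) {c₀ : ℝ} (hc₀ : 0 ≤ c₀) (h0 : I 0 c₀)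
    {δ : ℝ} (hδ : 0 < δ) : ∃ k, ∃ c, 0 ≤ c ∧ c ≤ δ ∧ I k c := by
  set e : ℕ → ℝ := fun k => Nat.rec c₀ (fun k c => (1 - b k) * c) k with he
  have hsucc : ∀ k, e (k + 1) = (1 - b k) * e k := fun k => rfl
  have hpos : ∀ k, 0 ≤ e k := by
    intro k
    induction k with
    | zero => exact hc₀
    | succ k ih => rw [hsucc]; exact mul_nonneg (by linarith [hb1 k]) ih
  have hinv : ∀ k, I k (e k) := by
    intro k
    induction k with
    | zero => exact h0
    | succ k ih => rw [hsucc]; exact hI k _ (hpos k) ih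
  have ht := tendsto_zero_of_le_one_sub_mul hb hs hpos fun k => (hsucc k).le
  obtain ⟨k, hk⟩ := (ht.eventually (gt_mem_nhds hδ)).exists
  exact ⟨k, e k, hpos k, hk.le, hinv k⟩

/-- Once `β * z ≤ δ / 2 * α`, dampening costs at most the pull towards `z` over a distance `δ / 2`,
so the deficit below `z - δ / 2` contracts by `1 - α`. The rates `α` are not summable because
eventually `β ≤ α`. -/
theorem eventually_sub_le_of_mann_step {α β x : ℕ → ℝ} {z : ℝ} (hα : ∀ n, 0 ≤ α n)
    (hα1 : ∀ n, α n ≤ 1) (hβ : ∀ n, 0 ≤ β n)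
    (hβ1 : ∀ n, β n ≤ 1) (hz : 0 ≤ z)
    (hβα : ∀ δ > 0, ∀ᶠ n in atTop, β n ≤ δ * α n) (hs : ¬ Summable β)
    (hx : ∀ᶠ n in atTop, (1 - β n) * ((1 - α n) * x n + α n * z) ≤ x (n + 1))
    {δ : ℝ} (hδ : 0 < δ) : ∀ᶠ n in atTop, z - δ ≤ x n := by
  have hsα : ¬ Summable α := by
    intro h
    refine hs (h.of_norm_bounded_eventually_nat ?_)
    filter_upwards [hβα 1 one_pos] with n hn
    rw [Real.norm_of_nonneg (hβ n)]; linarith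
  -- The divisor is `z + 1` because `z` may vanish.
  obtain ⟨N, hN⟩ := eventually_atTop.1 (hx.and (hβα (δ / 2 / (z + 1)) (by positivity)))
  have ht : Tendsto (fun n => max (z - δ / 2 - x (n + N)) 0) atTop (𝓝 0) := by
    refine tendsto_zero_of_le_one_sub_mul (a := fun n => α (n + N)) (fun n => hα _)
      (fun h => hsα ((summable_nat_add_iff N).1 h)) (fun n => le_max_right _ _) fun n => ?_
    obtain ⟨h1, h2⟩ := hN (n + N) (by omega)
    have h3 : β (n + N) * z ≤ δ / 2 * α (n + N) := by
      calc β (n + N) * z ≤ β (n + N) * (z + 1) :=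
            mul_le_mul_of_nonneg_left (by linarith) (hβ _)
        _ ≤ δ / 2 / (z + 1) * α (n + N) * (z + 1) :=
            mul_le_mul_of_nonneg_right h2 (by linarith)
        _ = δ / 2 * α (n + N) := by field_simp
    have hd0 := le_max_right (z - δ / 2 - x (n + N)) 0
    have hd1 := le_max_left (z - δ / 2 - x (n + N)) 0
    set d := max (z - δ / 2 - x (n + N)) 0
    have hα' : 0 ≤ 1 - α (n + N) := by linarith [hα1 (n + N)]
    refine max_le ?_ (mul_nonneg hα' hd0)
    have e : n + 1 + N = n + N + 1 := by ring
    rw [e]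
    have h4 : (1 - α (n + N)) * (z - δ / 2 - d) ≤ (1 - α (n + N)) * x (n + N) :=
      mul_le_mul_of_nonneg_left (by linarith) hα'
    have h5 : 0 ≤ β (n + N) * ((1 - α (n + N)) * (δ / 2 + d)) :=
      mul_nonneg (hβ _) (mul_nonneg hα' (by linarith))
    have h6 := mul_le_mul_of_nonneg_left h4 (sub_nonneg.2 (hβ1 (n + N)))
    nlinarith
  obtain ⟨K, hK⟩ := eventually_atTop.1 (ht.eventually (gt_mem_nhds (half_pos hδ)))
  filter_upwards [eventually_ge_atTop (K + N)] with n hn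
  have := (le_max_left _ _).trans_lt (hK (n - N) (by omega))
  rw [Nat.sub_add_cancel (by omega)] at this
  linarith

theorem not_summable_coe_of_tsum_eq_top {b : ℕ → ℝ≥0} (h : ∑' n, (b n : ℝ≥0∞) = ⊤) :
    ¬ Summable fun n => (b n : ℝ) := fun hs =>
  ENNReal.tsum_coe_ne_top_iff_summable.2 (NNReal.summable_coe.1 hs) h

/-! ### Least fixpoints -/

section LeastFix

variable {ι : Type*}

theorem leastFix_le {f : (ι → ℝ≥0) → ι → ℝ≥0} {u : ι → ℝ≥0∞}
    (h : ∀ y : ι → ℝ≥0, (∀ i, (y i : ℝ≥0∞) ≤ u i) → ∀ i, (f y i : ℝ≥0∞) ≤ u i) :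
    leastFix f ≤ u :=
  OrderHom.lfp_le _ (iSup_le fun y => h y.1 y.2)

theorem apply_le_leastFix {f : (ι → ℝ≥0) → ι → ℝ≥0} {y : ι → ℝ≥0}
    (hy : ∀ i, (y i : ℝ≥0∞) ≤ leastFix f i) (i : ι) : (f y i : ℝ≥0∞) ≤ leastFix f i := by
  have h : omegaExt f (leastFix f) = leastFix f := (omegaExt f).map_lfp
  have h2 : (fun i => (f y i : ℝ≥0∞)) ≤ omegaExt f (leastFix f) :=
    le_iSup (fun y : {y : ι → ℝ≥0 // ∀ i, (y i : ℝ≥0∞) ≤ leastFix f i} =>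
      fun i => (f y.1 i : ℝ≥0∞)) ⟨y, hy⟩
  rw [h] at h2
  exact h2 i

end LeastFix

/-! ### Bellman operators of Markov decision processes -/

namespace SSG

variable {S Act : Type*} [Fintype S]

theorem mem_actions {G : SSG S Act} {s : S} {a : Act} (ha : a ∈ G.A s) : a ∈ G.actions :=
  Set.mem_iUnion.2 ⟨s, ha⟩

theorem mass_le_one {G : SSG S Act} {s : S} {a : Act} (ha : a ∈ G.A s) : G.mass s a ≤ 1 :=
  G.sum_le_one s a (mem_actions ha)

theorem bellman_le {G : SSG S Act} {v : S → ℝ≥0} {s : S} {c : ℝ≥0∞}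
    (h : ∀ a ∈ G.A s, (G.actionValue v s a : ℝ≥0∞) ≤ c) : (G.bellman v s : ℝ≥0∞) ≤ c := by
  induction c with
  | top => exact le_top
  | coe c =>
    simp only [ENNReal.coe_le_coe] at h ⊢
    unfold bellman
    split_ifs with h1 h2
    · exact Finset.sup'_le _ _ h
    · exact (Finset.inf'_le _ h1.choose_spec).trans (h _ h1.choose_spec)
    · exact zero_le

/-- The only way in which the MDP hypothesis enters: with at most one action at a min-state, the
minimum is also a maximum. -/
theorem IsMDP.actionValue_le_bellman {G : SSG S Act} (hG : G.IsMDP) {v : S → ℝ≥0} {s : S} {a : Act}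
    (ha : a ∈ G.A s) : G.actionValue v s a ≤ G.bellman v s := by
  unfold bellman
  rw [dif_pos ⟨a, ha⟩]
  split_ifs with h
  · exact Finset.le_sup' _ ha
  · have hs : s ∈ G.Smin := by
      have := G.partition.compl_eq
      rw [← this]; exact h
    refine Finset.le_inf' _ _ fun b hb => ?_
    rw [Finset.card_le_one.1 (hG s hs) a ha b hb]

/-- A constant excess passes through with factor `mass ≤ 1`. Only successors are compared, so states
of infinite value do not interfere. -/
theorem actionValue_le_add {G : SSG S Act} {s : S} {a : Act} (ha : a ∈ G.A s) {x y : S → ℝ≥0}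
    {c : ℝ} (hc : 0 ≤ c) (h : ∀ t, G.T s a t ≠ 0 → (x t : ℝ) ≤ y t + c) :
    (G.actionValue x s a : ℝ) ≤ G.actionValue y s a + c := by
  have hm : (∑ t, (G.T s a t : ℝ)) ≤ 1 := by exact_mod_cast mass_le_one ha
  have h1 : ∑ t, (G.T s a t : ℝ) * x t ≤ ∑ t, (G.T s a t : ℝ) * (y t + c) := by
    refine Finset.sum_le_sum fun t _ => ?_
    by_cases ht : G.T s a t = 0
    · simp [ht]
    · exact mul_le_mul_of_nonneg_left (h t ht) (NNReal.coe_nonneg _)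
  simp only [mul_add, Finset.sum_add_distrib, ← Finset.sum_mul] at h1
  simp only [actionValue, NNReal.coe_add, NNReal.coe_sum, NNReal.coe_mul]
  nlinarith

/-- A vector concentrated on a successor of infinite value may be arbitrarily large, and a fixed
positive share of it reaches `s`. -/
theorem IsMDP.leastFix_ne_top {G : SSG S Act} (hG : G.IsMDP) {s t : S} {a : Act} (ha : a ∈ G.A s)
    (hs : leastFix G.bellman s ≠ ⊤) (ht : G.T s a t ≠ 0) : leastFix G.bellman t ≠ ⊤ := by
  classical
  intro htop
  apply hs
  refine ENNReal.eq_top_of_forall_nnreal_le fun r => ?_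
  have hy : ∀ i, ((Pi.single t (r / G.T s a t) : S → ℝ≥0) i : ℝ≥0∞) ≤ leastFix G.bellman i := by
    intro i
    by_cases hi : i = t
    · subst hi; rw [htop]; exact le_top
    · simp [Pi.single_eq_of_ne hi]
  refine le_trans ?_ (apply_le_leastFix hy s)
  rw [ENNReal.coe_le_coe]
  refine le_trans ?_ (hG.actionValue_le_bellman ha)
  calc r = G.T s a t * (Pi.single t (r / G.T s a t) : S → ℝ≥0) t := by
        rw [Pi.single_eq_same, mul_div_cancel₀ _ ht]
    _ ≤ ∑ t', G.T s a t' * (Pi.single t (r / G.T s a t) : S → ℝ≥0) t' :=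
        Finset.single_le_sum (f := fun t' => G.T s a t' * (Pi.single t (r / G.T s a t) : S → ℝ≥0) t')
          (fun _ _ => zero_le) (Finset.mem_univ t)
    _ ≤ _ := le_add_self

/-- `toNNReal` sends infinite values to `0`, so the truncated vector is still below the least
fixpoint. -/
theorem IsMDP.actionValue_leastFix_le {G : SSG S Act} (hG : G.IsMDP) {s : S} {a : Act}
    (ha : a ∈ G.A s) (hs : leastFix G.bellman s ≠ ⊤) :
    G.actionValue (fun t => (leastFix G.bellman t).toNNReal) s a ≤
      (leastFix G.bellman s).toNNReal := by
  rw [← ENNReal.coe_le_coe, ENNReal.coe_toNNReal hs]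
  refine le_trans ?_ (apply_le_leastFix (fun _ => ENNReal.coe_toNNReal_le_self) s)
  exact ENNReal.coe_le_coe.2 (hG.actionValue_le_bellman ha)

/-- The number of states with smaller value, plus one. -/
noncomputable def rank (v : S → ℝ≥0) (s : S) : ℕ := (Finset.univ.filter fun t => v t < v s).card + 1

theorem rank_lt_rank {v : S → ℝ≥0} {s t : S} (h : v t < v s) : rank v t < rank v s := by
  refine Nat.succ_lt_succ (Finset.card_lt_card ?_)
  refine Finset.ssubset_iff_of_subset (fun r hr => ?_) |>.2 ⟨t, by simpa using h, by simp⟩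
  simp only [Finset.mem_filter, Finset.mem_univ, true_and] at hr ⊢
  exact hr.trans h

/-- At a state where `v` does not increase, an action either loses mass, or reaches a state of
smaller value, or moves surely and without reward among states of the same value. -/
theorem leak_or_constant {G : SSG S Act} {v : S → ℝ≥0} {s : S} {a : Act} (ha : a ∈ G.A s)
    (h : G.actionValue v s a ≤ v s) :
    G.mass s a < 1 ∨ (∃ t, G.T s a t ≠ 0 ∧ v t < v s) ∨
      (G.mass s a = 1 ∧ G.R s a = 0 ∧ ∀ t, G.T s a t ≠ 0 → v t = v s) := by
  by_cases hm : G.mass s a < 1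
  · exact Or.inl hm
  by_cases ht : ∃ t, G.T s a t ≠ 0 ∧ v t < v s
  · exact Or.inr (Or.inl ht)
  push Not at ht
  have hm1 : G.mass s a = 1 := (mass_le_one ha).antisymm (not_lt.1 hm)
  -- Without a smaller successor the average of `v` is at least `v s`, so `h` forces zero reward and
  -- equality in every term.
  have hle : ∀ t, G.T s a t * v s ≤ G.T s a t * v t := by
    intro t
    by_cases h0 : G.T s a t = 0
    · simp [h0]
    · exact mul_le_mul_of_nonneg_left (ht t h0) zero_le
  have hsum : ∑ t, G.T s a t * v s = v s := by
    rw [← Finset.sum_mul]; exact (congrArg (· * v s) hm1).trans (one_mul _)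
  have h1 : v s ≤ ∑ t, G.T s a t * v t := hsum ▸ Finset.sum_le_sum fun t _ => hle t
  have hR : G.R s a = 0 := by
    have h2 : G.R s a + v s ≤ 0 + v s := by
      rw [zero_add]; exact (add_le_add_right h1 _).trans h
    exact le_antisymm (le_of_add_le_add_right h2) zero_le
  have h3 : ∑ t, G.T s a t * v s = ∑ t, G.T s a t * v t := by
    rw [hsum]; refine h1.antisymm ?_
    simpa [actionValue, hR] using h
  refine Or.inr (Or.inr ⟨hm1, hR, fun t h0 => ?_⟩)
  have := (Finset.sum_eq_sum_iff_of_le fun t _ => hle t).1 h3 t (Finset.mem_univ t)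
  exact (mul_left_cancel₀ h0 this).symm

/-- The potential `1 - q ^ rank` strictly decreases along every action that loses mass or reaches a
state of smaller rank with probability more than `q`. -/
theorem sum_potential_lt {G : SSG S Act} {v : S → ℝ≥0} {s : S} {a : Act} (ha : a ∈ G.A s) {q : ℝ}
    (hq : 0 < q) (hq1 : q < 1)
    (h : (q < 1 - (G.mass s a : ℝ)) ∨ ∃ t, q < G.T s a t ∧ v t < v s) :
    ∑ t, (G.T s a t : ℝ) * (1 - q ^ rank v t) < 1 - q ^ rank v s := by
  have hm : (G.mass s a : ℝ) ≤ 1 := by exact_mod_cast mass_le_one ha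
  have hmass : (G.mass s a : ℝ) = ∑ t, (G.T s a t : ℝ) := by simp [mass]
  have hexp : ∑ t, (G.T s a t : ℝ) * (1 - q ^ rank v t) =
      G.mass s a - ∑ t, (G.T s a t : ℝ) * q ^ rank v t := by
    simp only [mul_sub, mul_one, Finset.sum_sub_distrib, hmass]
  have hnn : ∀ t, 0 ≤ (G.T s a t : ℝ) * q ^ rank v t := fun t => by positivity
  rw [hexp]
  rcases h with h | ⟨t, ht, hvt⟩
  -- The added one in `rank` makes the exponent positive.
  · have h1 : q ^ rank v s ≤ q := pow_le_of_le_one hq.le hq1.le (Nat.succ_ne_zero _)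
    have h2 := Finset.sum_nonneg fun t (_ : t ∈ Finset.univ) => hnn t
    linarith
  · have h1 := Finset.single_le_sum (fun t _ => hnn t) (Finset.mem_univ t)
    have h2 : q ^ rank v s ≤ q ^ (rank v t + 1) :=
      pow_le_pow_of_le_one hq.le hq1.le (rank_lt_rank hvt)
    have h3 : q * q ^ rank v t < G.T s a t * q ^ rank v t :=
      mul_lt_mul_of_pos_right ht (pow_pos hq _)
    rw [pow_succ'] at h2
    linarith

/-- These are finitely many strict conditions, each true for all small `q > 0`. -/
theorem exists_potential_base (G : SSG S Act) : ∃ q : ℝ, 0 < q ∧ q < 1 ∧ ∀ s, ∀ a ∈ G.A s,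
    (G.mass s a < 1 → q < 1 - (G.mass s a : ℝ)) ∧ ∀ t, G.T s a t ≠ 0 → q < G.T s a t := by
  have key : ∀ c : ℝ, 0 < c → ∀ᶠ q in 𝓝[>] (0 : ℝ), q < c := fun c hc =>
    eventually_nhdsWithin_of_eventually_nhds (gt_mem_nhds hc)
  have h : ∀ᶠ q in 𝓝[>] (0 : ℝ), 0 < q ∧ q < 1 ∧ ∀ s, ∀ a ∈ G.A s,
      (G.mass s a < 1 → q < 1 - (G.mass s a : ℝ)) ∧ ∀ t, G.T s a t ≠ 0 → q < G.T s a t := by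
    refine eventually_mem_nhdsWithin.and ((key 1 one_pos).and ?_)
    refine eventually_all.2 fun s => (Finset.eventually_all _).2 fun a _ => ?_
    refine .and (eventually_imp_distrib_left.2 fun hm => key _ ?_)
      (eventually_all.2 fun t => eventually_imp_distrib_left.2 fun ht => key _ ?_)
    · exact sub_pos.2 (by exact_mod_cast hm)
    · exact_mod_cast pos_iff_ne_zero.2 ht
  exact h.exists

/-! ### Samplings -/

namespace IsSampling

variable {M : SSG S Act} {Mn : ℕ → SSG S Act}

theorem isMDP (h : M.IsSampling Mn) (hM : M.IsMDP) (n : ℕ) : (Mn n).IsMDP := by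
  intro s hs
  rw [h.A_eq]
  exact hM s (h.Smin_eq n ▸ hs)

theorem mem_A (h : M.IsSampling Mn) {n : ℕ} {s : S} {a : Act} : a ∈ (Mn n).A s ↔ a ∈ M.A s := by
  rw [h.A_eq]

theorem tendsto_actionValue (h : M.IsSampling Mn) {s : S} {a : Act} (ha : a ∈ M.A s)
    (v : S → ℝ≥0) :
    Tendsto (fun n => (Mn n).actionValue v s a) atTop (𝓝 (M.actionValue v s a)) :=
  (h.tendsto_R s a (mem_actions ha)).add
    (tendsto_finsetSum _ fun t _ => (h.tendsto_T s a (mem_actions ha) t).mul_const (v t))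

theorem bddAbove (h : M.IsSampling Mn) (n : ℕ) (v : S → ℝ≥0) (s : S) :
    BddAbove (Set.range fun k : Set.Ici n => (Mn k).bellman v s) := by
  have hb : ∀ a : M.A s, ∃ c, ∀ k, (Mn k).actionValue v s a ≤ c := fun a => by
    obtain ⟨c, hc⟩ := (h.tendsto_actionValue a.2 v).bddAbove_range
    exact ⟨c, fun k => hc ⟨k, rfl⟩⟩
  choose c hc using hb
  refine ⟨∑ a, c a, ?_⟩
  rintro _ ⟨k, rfl⟩
  rw [← ENNReal.coe_le_coe]
  refine bellman_le fun a ha => ENNReal.coe_le_coe.2 ?_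
  rw [h.mem_A] at ha
  exact (hc ⟨a, ha⟩ k).trans
    (Finset.single_le_sum (f := c) (fun _ _ => zero_le) (Finset.mem_univ _))

/-- A finite super-fixpoint `v` of the Bellman operator of `M` can be perturbed by an arbitrarily
small amount to a super-fixpoint for almost all members of a sampling. -/
theorem exists_superFixpoint (h : M.IsSampling Mn) (v : S → ℝ≥0) {ε : ℝ≥0} (hε : 0 < ε) :
    ∃ u : S → ℝ≥0, (∀ s, u s ≤ v s + ε) ∧ ∀ᶠ k in atTop, ∀ s, ∀ a ∈ M.A s,
      M.actionValue v s a ≤ v s → (Mn k).actionValue u s a ≤ u s := by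
  obtain ⟨q, hq, hq1, hG⟩ := M.exists_potential_base
  have hw : ∀ s, 0 ≤ 1 - q ^ rank v s := fun s => sub_nonneg.2 (pow_le_one₀ hq.le hq1.le)
  set u : S → ℝ≥0 := fun s => v s + ε * (1 - q ^ rank v s).toNNReal with hu
  have hucoe : ∀ s, (u s : ℝ) = v s + ε * (1 - q ^ rank v s) := fun s => by
    simp only [hu, NNReal.coe_add, NNReal.coe_mul, Real.coe_toNNReal _ (hw s)]
  refine ⟨u, fun s => ?_, ?_⟩
  · have : (1 - q ^ rank v s).toNNReal ≤ 1 :=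
      Real.toNNReal_le_one.2 (by linarith [pow_pos hq (rank v s)])
    exact add_le_add_right (mul_le_of_le_one_right zero_le this) _
  refine eventually_all.2 fun s => (Finset.eventually_all _).2 fun a ha =>
    eventually_imp_distrib_left.2 fun hv => ?_
  have leak : ((q < 1 - (M.mass s a : ℝ)) ∨ ∃ t, q < M.T s a t ∧ v t < v s) →
      ∀ᶠ k in atTop, (Mn k).actionValue u s a ≤ u s := by
    intro hl
    have h1 := sum_potential_lt ha hq hq1 hl
    have h2 : M.actionValue u s a < u s := by
      have hv' : (M.R s a : ℝ) + ∑ t, (M.T s a t : ℝ) * v t ≤ v s := by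
        exact_mod_cast hv
      have h3 : ∑ t, (M.T s a t : ℝ) * u t = ∑ t, (M.T s a t : ℝ) * v t +
          ε * ∑ t, (M.T s a t : ℝ) * (1 - q ^ rank v t) := by
        rw [Finset.mul_sum, ← Finset.sum_add_distrib]
        refine Finset.sum_congr rfl fun t _ => ?_
        rw [hucoe]
        ring
      have h4 := mul_lt_mul_of_pos_left h1 (NNReal.coe_pos.2 hε)
      rw [← NNReal.coe_lt_coe]
      simp only [actionValue, NNReal.coe_add, NNReal.coe_sum, NNReal.coe_mul]
      rw [h3, hucoe]
      linarith
    exact ((h.tendsto_actionValue ha u).eventually (gt_mem_nhds h2)).mono fun _ hk => hk.le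
  rcases leak_or_constant ha hv with hm | ⟨t, ht, hvt⟩ | ⟨hm, hR, hc⟩
  · exact leak (Or.inl ((hG s a ha).1 hm))
  · exact leak (Or.inr ⟨t, (hG s a ha).2 t ht, hvt⟩)
  -- The sampling conditions say nothing about index `0`.
  · filter_upwards [eventually_ge_atTop 1] with k hk
    have hmem := mem_actions ha
    have hcu : ∀ t, M.T s a t ≠ 0 → u t = u s := fun t ht => by
      simp only [hu, rank, hc t ht]
    have h1 : ∑ t, (Mn k).T s a t * u t = ∑ t, (Mn k).T s a t * u s := by
      refine Finset.sum_congr rfl fun t _ => ?_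
      by_cases ht : M.T s a t = 0
      · simp [h.T_zero s a hmem t ht k hk]
      · rw [hcu t ht]
    rw [actionValue, h.R_zero s a hmem hR k hk, h1, ← Finset.sum_mul, zero_add]
    exact (congrArg (· * u s) (h.mass_one s a hmem hm k hk)).le.trans (one_mul _).le

/-- The slack `c` serves the Mann iterations. Transitions of late `Mn k` are transitions of `M`, so
they stay where the least fixpoint is finite, and `u` is irrelevant elsewhere. -/
theorem exists_superFixpoint_leastFix (h : M.IsSampling Mn) (hM : M.IsMDP) {ε : ℝ≥0}
    (hε : 0 < ε) : ∃ u : S → ℝ≥0,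
      (∀ s, leastFix M.bellman s ≠ ⊤ → (u s : ℝ≥0∞) ≤ leastFix M.bellman s + ε) ∧
      ∀ᶠ k in atTop, ∀ (x : S → ℝ≥0) (c : ℝ), 0 ≤ c →
        (∀ s ∈ {s | leastFix M.bellman s ≠ ⊤}, (x s : ℝ) ≤ u s + c) →
        ∀ s ∈ {s | leastFix M.bellman s ≠ ⊤}, ((Mn k).bellman x s : ℝ) ≤ u s + c := by
  obtain ⟨u, hu, hk⟩ := h.exists_superFixpoint (fun s => (leastFix M.bellman s).toNNReal) hε
  refine ⟨u, fun s hs => ?_, ?_⟩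
  · rw [← ENNReal.coe_toNNReal hs, ← ENNReal.coe_add]
    exact ENNReal.coe_le_coe.2 (hu s)
  filter_upwards [hk, eventually_ge_atTop 1] with k hk hk1 x c hc hx s hs
  lift c to ℝ≥0 using hc
  rw [← NNReal.coe_add, NNReal.coe_le_coe, ← ENNReal.coe_le_coe]
  refine bellman_le fun a ha => ?_
  have ha' := h.mem_A.1 ha
  rw [ENNReal.coe_le_coe, ← NNReal.coe_le_coe, NNReal.coe_add]
  refine (actionValue_le_add ha c.2 (y := u) fun t ht => hx t ?_).trans ?_
  · exact hM.leastFix_ne_top ha' hs fun h0 => ht (h.T_zero s a (mem_actions ha') t h0 k hk1)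
  · exact add_le_add_left
      (NNReal.coe_le_coe.2 (hk s a ha' (hM.actionValue_leastFix_le ha' hs))) _

theorem leastFix_le_leastFix_tailSup (h : M.IsSampling Mn) (hM : M.IsMDP) (n : ℕ) :
    leastFix M.bellman ≤ leastFix (tailSup (fun k => (Mn k).bellman) n) := by
  refine leastFix_le fun y hy s => ?_
  refine le_trans ?_ (apply_le_leastFix hy s)
  refine bellman_le fun a ha => ENNReal.coe_le_coe.2 ?_
  refine le_of_tendsto (h.tendsto_actionValue ha y) ?_
  filter_upwards [eventually_ge_atTop n] with k hk
  exact ((h.isMDP hM k).actionValue_le_bellman (h.mem_A.2 ha)).trans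
    (le_ciSup (h.bddAbove n y s) ⟨k, hk⟩)

theorem tendsto_leastFix_tailSup (h : M.IsSampling Mn) (hM : M.IsMDP) :
    Tendsto (fun n => leastFix (tailSup (fun k => (Mn k).bellman) n)) atTop
      (𝓝 (leastFix M.bellman)) := by
  classical
  refine tendsto_pi_nhds.2 fun s => ?_
  refine tendsto_order.2 ⟨fun b hb => .of_forall fun n =>
    hb.trans_le (h.leastFix_le_leastFix_tailSup hM n s), fun b hb => ?_⟩
  obtain ⟨ε, hε, hεb⟩ := ENNReal.lt_iff_exists_add_pos_lt.1 hb
  obtain ⟨u, hu, hk⟩ := h.exists_superFixpoint_leastFix hM hε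
  obtain ⟨N, hN⟩ := eventually_atTop.1 hk
  filter_upwards [eventually_ge_atTop N] with n hn
  -- The vector that is `u` on the finite part and `⊤` elsewhere is a super-fixpoint of the tail
  -- supremum.
  have key : leastFix (tailSup (fun k => (Mn k).bellman) n) ≤
      fun t => if leastFix M.bellman t = ⊤ then ⊤ else (u t : ℝ≥0∞) := by
    refine leastFix_le fun y hy t => ?_
    split_ifs with ht
    · exact le_top
    · refine ENNReal.coe_le_coe.2 (ciSup_le fun k => ?_)
      have := hN k (hn.trans k.2) y 0 le_rfl (fun r hr => ?_) t ht
      · simpa using this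
      · have h1 := hy r
        rw [if_neg hr, ENNReal.coe_le_coe] at h1
        simpa using h1
  have hs := ne_top_of_lt hb
  refine (key s).trans_lt ?_
  simp only [if_neg hs]
  exact (hu s hs).trans_lt hεb

end IsSampling

end SSG

/-! ### Dampened Mann schemes -/

/-- A dampened Mann scheme as a generalized one with constant parameters. -/
def MannScheme.toGen (𝒮 : MannScheme) (ι : Type*) : GenMannScheme ι where
  α n _ := 𝒮.α n
  β n _ := 𝒮.β n
  α_le_one n _ := 𝒮.α_le_one n
  β_lt_one n _ := 𝒮.β_lt_one n
  tendsto_β _ := 𝒮.tendsto_β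
  tsum_β _ := 𝒮.tsum_β

namespace GenMannScheme

variable {ι : Type*} {𝒮 : GenMannScheme ι} {f : ℕ → (ι → ℝ≥0) → ι → ℝ≥0} {x : ℕ → ι → ℝ≥0}

/-- Dampening `u + c` also shrinks `u`; giving that gain away leaves `u` fixed and contracts only
the excess. -/
theorem Generates.step_le (hx : 𝒮.Generates f x) {n : ℕ} {i : ι} {u c : ℝ} (hu : 0 ≤ u)
    (h1 : (x n i : ℝ) ≤ u + c) (h2 : (f n (x n) i : ℝ) ≤ u + c) :
    (x (n + 1) i : ℝ) ≤ u + (1 - 𝒮.β n i) * c := by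
  have hα1 : (𝒮.α n i : ℝ) ≤ 1 := 𝒮.α_le_one n i
  have hα0 := (𝒮.α n i).coe_nonneg
  have hβ0 := (𝒮.β n i).coe_nonneg
  have hβ1 : (𝒮.β n i : ℝ) ≤ 1 := (𝒮.β_lt_one n i).le
  rw [hx n i]
  have h3 : (x n i : ℝ) + 𝒮.α n i * (f n (x n) i - x n i) ≤ u + c := by
    nlinarith [mul_le_mul_of_nonneg_left h1 (sub_nonneg.2 hα1), mul_le_mul_of_nonneg_left h2 hα0]
  nlinarith [mul_le_mul_of_nonneg_left h3 (sub_nonneg.2 hβ1), mul_nonneg hβ0 hu]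

theorem Generates.le_of_eq_zero (hx : 𝒮.Generates f x) {n : ℕ} {i : ι} (h : 𝒮.α n i = 0) :
    (x (n + 1) i : ℝ) ≤ x n i := by
  rw [hx n i, h, NNReal.coe_zero, zero_mul, add_zero]
  nlinarith [mul_nonneg (𝒮.β n i).coe_nonneg (x n i).coe_nonneg]

/-- The iteration stays below `u + c` on `F` once it is there, if the functions preserve this. -/
theorem Generates.le_add_of_le (hx : 𝒮.Generates f x) {F : Set ι} {u : ι → ℝ≥0} {N : ℕ}
    (hf : ∀ n ≥ N, ∀ (y : ι → ℝ≥0) (c : ℝ), 0 ≤ c → (∀ i ∈ F, (y i : ℝ) ≤ u i + c) →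
      ∀ i ∈ F, (f n y i : ℝ) ≤ u i + c)
    {c : ℝ} (hc : 0 ≤ c) {n : ℕ} (hn : N ≤ n) (h : ∀ i ∈ F, (x n i : ℝ) ≤ u i + c) :
    ∀ k ≥ n, ∀ i ∈ F, (x k i : ℝ) ≤ u i + c := by
  intro k hk
  induction k, hk using Nat.le_induction with
  | base => exact h
  | succ k hk ih =>
    intro i hi
    refine (hx.step_le (u i).coe_nonneg (ih i hi) (hf k (hn.trans hk) _ c hc ih i hi)).trans ?_
    nlinarith [mul_nonneg (𝒮.β k i).coe_nonneg hc]

/-- An update may lift a component back to `u + c` while others have not contracted, so only its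
last update in a block counts. Afterwards `α = 0` and it cannot grow, so each block contracts the
common bound by the smallest of these last factors. -/
theorem Generates.eventually_le (hx : 𝒮.Generates f x) [Fintype ι] (h𝒮 : 𝒮.Progressing) {F : Set ι}
    {u : ι → ℝ≥0}
    (hf : ∀ᶠ n in atTop, ∀ (y : ι → ℝ≥0) (c : ℝ), 0 ≤ c → (∀ i ∈ F, (y i : ℝ) ≤ u i + c) →
      ∀ i ∈ F, (f n y i : ℝ) ≤ u i + c)
    {δ : ℝ} (hδ : 0 < δ) : ∀ᶠ n in atTop, ∀ i ∈ F, (x n i : ℝ) ≤ u i + δ := by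
  obtain ⟨N, hN⟩ := eventually_atTop.1 hf
  obtain ⟨-, m, l, hm, hl, htop⟩ := h𝒮
  rcases isEmpty_or_nonempty ι with hι | hι
  · exact .of_forall fun n i => (hι.false i).elim
  set b : ℕ → ℝ≥0 := fun k => (⨅ i, (𝒮.β (l k i) i : ℝ≥0∞)).toNNReal
  have hbb : ∀ k, (b k : ℝ≥0∞) = ⨅ i, (𝒮.β (l k i) i : ℝ≥0∞) := fun k =>
    ENNReal.coe_toNNReal (ne_top_of_le_ne_top ENNReal.coe_ne_top (iInf_le _ (Classical.arbitrary ι)))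
  have hble : ∀ k i, b k ≤ 𝒮.β (l k i) i := fun k i => by
    rw [← ENNReal.coe_le_coe, hbb]; exact iInf_le _ i
  have hb1 : ∀ k, b k ≤ 1 := fun k =>
    (hble k (Classical.arbitrary ι)).trans (𝒮.β_lt_one _ _).le
  have hs : ¬ Summable fun k => (b (k + N) : ℝ) := fun h =>
    not_summable_coe_of_tsum_eq_top (by simpa only [hbb] using htop)
      ((summable_nat_add_iff (f := fun k => (b k : ℝ)) N).1 h)
  have hNm : ∀ k, N ≤ m (k + N) := fun k => le_trans (by omega) hm.le_apply
  have hstep : ∀ k (c : ℝ), 0 ≤ c → (∀ i ∈ F, (x (m (k + N)) i : ℝ) ≤ u i + c) →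
      ∀ i ∈ F, (x (m (k + 1 + N)) i : ℝ) ≤ u i + (1 - b (k + N)) * c := by
    intro k c hc h i hi
    have e : k + 1 + N = k + N + 1 := by ring
    rw [e]
    generalize hK : k + N = K at *
    obtain ⟨⟨hl1, hl2, -⟩, hl3⟩ := hl K i
    have hinv := hx.le_add_of_le hN hc (hK ▸ hNm k) h
    have hlN : N ≤ l K i := (hK ▸ hNm k : N ≤ m K).trans hl1
    have hlast : ∀ n, l K i + 1 ≤ n → n ≤ m (K + 1) →
        (x n i : ℝ) ≤ u i + (1 - 𝒮.β (l K i) i) * c := by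
      intro n hn
      induction n, hn using Nat.le_induction with
      | base =>
        intro _
        exact hx.step_le (u i).coe_nonneg (hinv _ hl1 i hi)
          (hN _ hlN _ c hc (hinv _ hl1) i hi)
      | succ n hn ih =>
        intro hn'
        refine (hx.le_of_eq_zero ?_).trans (ih (by omega))
        by_contra h0
        have : n ≤ l K i := hl3 ⟨by omega, by omega, pos_iff_ne_zero.2 h0⟩
        omega
    refine (hlast _ hl2 le_rfl).trans ?_
    have : (b K : ℝ) ≤ 𝒮.β (l K i) i := hble K i
    nlinarith
  obtain ⟨k, c, hc, hcδ, hk⟩ := exists_le_of_contracting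
    (I := fun k c => ∀ i ∈ F, (x (m (k + N)) i : ℝ) ≤ u i + c) (b := fun k => (b (k + N) : ℝ))
    (fun k => NNReal.coe_nonneg _) (fun k => by exact_mod_cast hb1 _) hs hstep
    (c₀ := ∑ i, (x (m (0 + N)) i : ℝ)) (Finset.sum_nonneg fun _ _ => NNReal.coe_nonneg _)
    (fun i _ => by
      have := Finset.single_le_sum (f := fun i => (x (m (0 + N)) i : ℝ))
        (fun _ _ => NNReal.coe_nonneg _) (Finset.mem_univ i)
      linarith [(u i).coe_nonneg]) hδ
  filter_upwards [eventually_ge_atTop (m (k + N))] with n hn i hi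
  linarith [hx.le_add_of_le hN hc (hNm k) hk n hn i hi]

end GenMannScheme

/-- All components contract by the same factor, so every single step serves as a block. -/
theorem MannScheme.eventually_le_of_generates {ι : Type*} [Fintype ι] {𝒮 : MannScheme}
    {f : ℕ → (ι → ℝ≥0) → ι → ℝ≥0} {x : ℕ → ι → ℝ≥0} (hx : 𝒮.Generates f x) {F : Set ι}
    {u : ι → ℝ≥0}
    (hf : ∀ᶠ n in atTop, ∀ (y : ι → ℝ≥0) (c : ℝ), 0 ≤ c → (∀ i ∈ F, (y i : ℝ) ≤ u i + c) →
      ∀ i ∈ F, (f n y i : ℝ) ≤ u i + c)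
    {δ : ℝ} (hδ : 0 < δ) : ∀ᶠ n in atTop, ∀ i ∈ F, (x n i : ℝ) ≤ u i + δ := by
  obtain ⟨N, hN⟩ := eventually_atTop.1 hf
  have hg : (𝒮.toGen ι).Generates f x := hx
  have hs : ¬ Summable fun k => (𝒮.β (k + N) : ℝ) := fun h =>
    not_summable_coe_of_tsum_eq_top 𝒮.tsum_β
      ((summable_nat_add_iff (f := fun k => (𝒮.β k : ℝ)) N).1 h)
  obtain ⟨k, c, hc, hcδ, hk⟩ := exists_le_of_contracting
    (I := fun k c => ∀ i ∈ F, (x (k + N) i : ℝ) ≤ u i + c) (b := fun k => (𝒮.β (k + N) : ℝ))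
    (fun k => NNReal.coe_nonneg _) (fun k => by exact_mod_cast (𝒮.β_lt_one _).le) hs
    (fun k c hc h i hi => by
      have e : k + 1 + N = k + N + 1 := by ring
      rw [e]
      exact hg.step_le (u i).coe_nonneg (h i hi) (hN _ (by omega) _ c hc h i hi))
    (c₀ := ∑ i, (x (0 + N) i : ℝ)) (Finset.sum_nonneg fun _ _ => NNReal.coe_nonneg _)
    (fun i _ => by
      have := Finset.single_le_sum (f := fun i => (x (0 + N) i : ℝ))
        (fun _ _ => NNReal.coe_nonneg _) (Finset.mem_univ i)
      linarith [(u i).coe_nonneg]) hδ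
  filter_upwards [eventually_ge_atTop (k + N)] with n hn i hi
  linarith [hg.le_add_of_le hN hc (by omega) hk n hn i hi]

/-! ### Convergence of dampened Mann iterations on samplings -/

namespace SSG.IsSampling

variable {S Act : Type*} [Fintype S] {M : SSG S Act} {Mn : ℕ → SSG S Act}

/-- If `y` lies below the liminf, the iterates are eventually almost above `y`, so every action
value at `y` is almost a lower bound for the later updates, to which the iteration is drawn. -/
theorem leastFix_le_liminf (h : M.IsSampling Mn) (hM : M.IsMDP) {𝒮 : GenMannScheme S}
    (h𝒮 : ∀ s, Tendsto (fun n => (𝒮.β n s : ℝ≥0∞) / (𝒮.α n s : ℝ≥0∞)) atTop (𝓝 0))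
    {x : ℕ → S → ℝ≥0} (hx : 𝒮.Generates (fun n => (Mn n).bellman) x) :
    leastFix M.bellman ≤ fun s => liminf (fun n => (x n s : ℝ≥0∞)) atTop := by
  refine leastFix_le fun y hy s => bellman_le fun a ha => ?_
  have hβα : ∀ δ > (0 : ℝ), ∀ᶠ n in atTop, (𝒮.β n s : ℝ) ≤ δ * 𝒮.α n s := by
    intro δ hδ
    lift δ to ℝ≥0 using hδ.le
    have hδ' : (0 : ℝ≥0∞) < δ := by exact_mod_cast hδ
    filter_upwards [(h𝒮 s).eventually (gt_mem_nhds hδ')] with n hn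
    have h1 := (ENNReal.div_le_iff_le_mul (Or.inr ENNReal.coe_ne_top)
      (Or.inl ENNReal.coe_ne_top)).1 hn.le
    exact_mod_cast h1
  have hnear : ∀ η > (0 : ℝ), ∀ᶠ n in atTop, ∀ t, (y t : ℝ) ≤ x n t + η := by
    intro η hη
    refine eventually_all.2 fun t => ?_
    lift η to ℝ≥0 using hη.le
    -- Passing to the iterates needs a strict inequality below the liminf, and `y t - η < y t` fails
    -- when `y t = 0`.
    rcases le_or_gt (y t) η with hle | hlt
    · refine .of_forall fun n => ?_
      have : (y t : ℝ) ≤ η := hle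
      linarith [(x n t).coe_nonneg]
    · have h1 : ((y t - η : ℝ≥0) : ℝ≥0∞) < liminf (fun n => (x n t : ℝ≥0∞)) atTop :=
        lt_of_lt_of_le (ENNReal.coe_lt_coe.2
          (tsub_lt_self (zero_le.trans_lt hlt) (by exact_mod_cast hη))) (hy t)
      filter_upwards [eventually_lt_of_lt_liminf h1] with n hn
      have h2 : y t - η ≤ x n t := (ENNReal.coe_lt_coe.1 hn).le
      exact_mod_cast tsub_le_iff_right.1 h2
  refine ENNReal.le_of_forall_pos_le_add fun ε hε _ => ?_
  have hε' : (0 : ℝ) < ε := hε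
  have hmain : ∀ᶠ n in atTop, (M.actionValue y s a : ℝ) - ε ≤ x n s := by
    have hz : ∀ᶠ n in atTop, (M.actionValue y s a : ℝ) - ε / 4 ≤ (Mn n).actionValue y s a :=
      ((NNReal.tendsto_coe.2 (h.tendsto_actionValue ha y)).eventually
        (lt_mem_nhds (show (M.actionValue y s a : ℝ) - ε / 4 < _ by linarith))).mono
        fun _ hn => hn.le
    have := eventually_sub_le_of_mann_step (α := fun n => (𝒮.α n s : ℝ))
      (β := fun n => (𝒮.β n s : ℝ)) (x := fun n => (x n s : ℝ))
      -- One `ε / 4` is lost to the iterates and one to the sampled action value; the maximum with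
      -- `0` keeps the target non-negative.
      (z := max ((M.actionValue y s a : ℝ) - ε / 2) 0) (fun n => NNReal.coe_nonneg _)
      (fun n => 𝒮.α_le_one n s) (fun n => NNReal.coe_nonneg _) (fun n => (𝒮.β_lt_one n s).le)
      (le_max_right _ _) hβα (not_summable_coe_of_tsum_eq_top (𝒮.tsum_β s)) ?_ (half_pos hε')
    · filter_upwards [this] with n hn
      linarith [le_max_left ((M.actionValue y s a : ℝ) - ε / 2) 0]
    · filter_upwards [hnear (ε / 4) (by linarith), hz] with n hn hzn
      have hle : max ((M.actionValue y s a : ℝ) - ε / 2) 0 ≤ (Mn n).bellman (x n) s := by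
        refine max_le ?_ (NNReal.coe_nonneg _)
        have h1 := actionValue_le_add (h.mem_A (n := n).2 ha) (by linarith) fun t _ => hn t
        have h2 : ((Mn n).actionValue (x n) s a : ℝ) ≤ (Mn n).bellman (x n) s :=
          (h.isMDP hM n).actionValue_le_bellman (h.mem_A.2 ha)
        linarith
      rw [hx n s]
      refine mul_le_mul_of_nonneg_left ?_ (sub_nonneg.2 (𝒮.β_lt_one n s).le)
      linarith [mul_le_mul_of_nonneg_left hle (𝒮.α n s).coe_nonneg]
  have h1 : (M.actionValue y s a - ε : ℝ≥0∞) ≤ liminf (fun n => (x n s : ℝ≥0∞)) atTop := by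
    refine le_liminf_of_le (by isBoundedDefault) ?_
    filter_upwards [hmain] with n hn
    refine tsub_le_iff_right.2 ?_
    have : (M.actionValue y s a : ℝ) ≤ x n s + ε := by linarith
    exact_mod_cast this
  exact tsub_le_iff_right.1 h1

/-- The iterates of a scheme with `β / α → 0` converge to the least fixpoint if, where the latter is
finite, they are eventually below each eventual super-fixpoint up to an arbitrarily small error. -/
theorem tendsto_of_generates (h : M.IsSampling Mn) (hM : M.IsMDP) {𝒮 : GenMannScheme S}
    (h𝒮 : ∀ s, Tendsto (fun n => (𝒮.β n s : ℝ≥0∞) / (𝒮.α n s : ℝ≥0∞)) atTop (𝓝 0))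
    {x : ℕ → S → ℝ≥0} (hx : 𝒮.Generates (fun n => (Mn n).bellman) x)
    (hupper : ∀ (F : Set S) (u : S → ℝ≥0),
      (∀ᶠ n in atTop, ∀ (y : S → ℝ≥0) (c : ℝ), 0 ≤ c → (∀ s ∈ F, (y s : ℝ) ≤ u s + c) →
        ∀ s ∈ F, ((Mn n).bellman y s : ℝ) ≤ u s + c) →
      ∀ δ : ℝ, 0 < δ → ∀ᶠ n in atTop, ∀ s ∈ F, (x n s : ℝ) ≤ u s + δ) :
    Tendsto (fun n s => (x n s : ℝ≥0∞)) atTop (𝓝 (leastFix M.bellman)) := by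
  refine tendsto_pi_nhds.2 fun s => tendsto_order.2 ⟨fun b hb => ?_, fun b hb => ?_⟩
  · exact eventually_lt_of_lt_liminf (hb.trans_le (h.leastFix_le_liminf hM h𝒮 hx s))
  · obtain ⟨ε, hε, hεb⟩ := ENNReal.lt_iff_exists_add_pos_lt.1 hb
    have hs := ne_top_of_lt hb
    obtain ⟨u, hu, hk⟩ := h.exists_superFixpoint_leastFix hM (half_pos hε)
    filter_upwards [hupper _ u hk (ε / 2 : ℝ≥0) (NNReal.coe_pos.2 (half_pos hε))] with n hn
    refine lt_of_le_of_lt ?_ hεb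
    have h1 : x n s ≤ u s + ε / 2 := by exact_mod_cast hn s hs
    calc (x n s : ℝ≥0∞) ≤ u s + (ε / 2 : ℝ≥0) := by exact_mod_cast h1
      _ ≤ leastFix M.bellman s + (ε / 2 : ℝ≥0) + (ε / 2 : ℝ≥0) := by gcongr; exact hu s hs
      _ = leastFix M.bellman s + ε := by rw [add_assoc, ← ENNReal.coe_add, add_halves]

end SSG.IsSampling

theorem mainTheorem5 {S Act : Type*} [Fintype S] (M : SSG S Act) (Mn : ℕ → SSG S Act)
    (hM : M.IsMDP) (hMn : M.IsSampling Mn) :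
    -- the pointwise suprema are taken over bounded sets, so they are finite
    (∀ (n : ℕ) (v : S → ℝ≥0) (s : S),
      BddAbove (Set.range fun k : Set.Ici n => (Mn k).bellman v s)) ∧
    Tendsto (fun n => leastFix (tailSup (fun k => (Mn k).bellman) n)) atTop
      (𝓝 (leastFix M.bellman)) ∧
    (∀ 𝒮 : MannScheme, 𝒮.Progressing →
      ∀ x : ℕ → S → ℝ≥0, 𝒮.Generates (fun n => (Mn n).bellman) x →
        Tendsto (fun n s => (x n s : ℝ≥0∞)) atTop (𝓝 (leastFix M.bellman))) ∧
    (∀ 𝒮 : GenMannScheme S, 𝒮.Progressing →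
      ∀ x : ℕ → S → ℝ≥0, 𝒮.Generates (fun n => (Mn n).bellman) x →
        Tendsto (fun n s => (x n s : ℝ≥0∞)) atTop (𝓝 (leastFix M.bellman))) := by
  refine ⟨hMn.bddAbove, hMn.tendsto_leastFix_tailSup hM, fun 𝒮 h𝒮 x hx => ?_,
    fun 𝒮 h𝒮 x hx => ?_⟩
  · exact hMn.tendsto_of_generates hM (𝒮 := 𝒮.toGen S) (fun _ => h𝒮) hx
      fun F u hf δ hδ => MannScheme.eventually_le_of_generates hx hf hδ
  · exact hMn.tendsto_of_generates hM h𝒮.1 hx fun F u hf δ hδ => hx.eventually_le h𝒮 hf hδ
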